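/- Let $d\in\{2,3\}$ and let $\Omega\subset\mathbb R^d$ be a nonempty polygonal/polyhedral open set. Write $(\cdot,\cdot)$, $\|\cdot\|$ for the scalar product and norm of $L^2(\Omega)$, and let $k\ge1$. Let $V,W\subset H^1(\Omega)$ be subspaces and $a:V\times W\to\mathbb R$ a bilinear form such that for all $f,g\in L^2(\Omega)$ the forward problem ($u\in V$, $a(u,w)=(f,w)$ for all $w\in W$) and the adjoint problem ($z\in W$, $a(v,z)=(g,v)$ for all $v\in V$) are uniquely solvable, with solutions in $H^2(\Omega)$ satisfying $|u|_{H^2(\Omega)}\le c_{a,\Omega}\|f\|$ and $|z|_{H^2(\Omega)}\le c_{a,\Omega}\|g\|$. Let $\mathcal T_h$ be a conforming triangulation of $\Omega$ with mesh size $h=\max_{K\in\mathcal T_h}\operatorname{diam}K$, and let $V_h=W_h$ be a subspace of $X_h^k=\{v\in H^1(\Omega): v|_K\in\mathbb P_k(K)\ \forall K\in\mathcal T_h\}$. Put $V^m=V\cap H^m(\Omega)$ and $W^m=W\cap H^m(\Omega)$. Let $a_h$ be a bilinear form on $(V^2+V_h)\times(W^2+V_h)$, let $s_p$ and $s_a$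 be symmetric positive semi-definite bilinear forms on $V^{k+1}+V_h$ and $W^{k+1}+V_h$, respectively, and set $|x|_{S_y}=s_y(x,x)^{1/2}$ for $y=p,a$. Let $\pi_V:V^2\to V_h$ and $\pi_W:W^2\to V_h$ be maps, $\|\cdot\|_+$ and $\|\cdot\|_{\mathcal L}$ seminorms on $V^2+V_h$, $\|\cdot\|_*$ a seminorm on $W^2+V_h$, and $\epsilon=\epsilon(h)\ge0$. Assume: 1. (Strong consistency) If $u$ solves the forward problem with data $f$, then $a_h(u,\varphi)=(f,\varphi)$ for all $\varphi\in W^2+V_h$; if $z$ solves the adjoint problem with data $g$, then $a_h(\phi,z)=(\phi,g)$ for all $\phi\in V^2+V_h$. 2. (Interpolation) $\|v-\pi_Vv\|+h\|\nabla(v-\pi_Vv)\|\le c_ih^{k+1}|v|_{H^{k+1}(\Omega)}$ for all $v\in V^{k+1}$, and the same for $\pi_W$ on $W^{k+1}$. 3. (Continuity) For all $v\in V^2$, $y\in W^2$ and $v_h,x_h\in V_h$, $$a_h(v-\pi_Vv,x_h)\le\|v-\pi_Vv\|_+\,(c_a|x_h|_{S_a}+\epsilon\|x_h\|),$$ $$a_h(v-v_h,y-\pi_Wy)\le\|y-\pi_Wy\|_*\,(c_a\|v-\pi_Vv\|_{\mathcal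 L}+c_a|v_h-\pi_Vv|_{S_p}+\epsilon\|v-v_h\|).$$ 4. (Approximation) For all $v\in V^{k+1}$, $w\in W^{k+1}$, $$\|v-\pi_Vv\|_{\mathcal L}+\|v-\pi_Vv\|_++|v-\pi_Vv|_{S_p}\le c_{a,\gamma}h^k|v|_{H^{k+1}(\Omega)},\qquad \|w-\pi_Ww\|_*+|w-\pi_Ww|_{S_a}\le c_{a,\gamma}h^k|w|_{H^{k+1}(\Omega)},$$ and for all $v\in V^2$, $w\in W^2$: $\|v-\pi_Vv\|_+\le c_{a,\gamma}h|v|_{H^2(\Omega)}$ and $\|w-\pi_Ww\|_*\le c_{a,\gamma}h|w|_{H^2(\Omega)}$. 5. (Upper bounds) $|\pi_Vv|_{S_p}\le c_{a,\gamma}h|v|_{H^2(\Omega)}$ for all $v\in V^2$ and $|\pi_Ww|_{S_a}\le c_{a,\gamma}h|w|_{H^2(\Omega)}$ for all $w\in W^2$. 6. (Smallness) $c_{a,\gamma}\,c_{a,\Omega}\,h\,\epsilon\le\frac16$. 7. (Discrete Gårding inequality) For some $\lambda\in\mathbb R$, $\|\nabla v_h\|^2-\lambda\|v_h\|^2\le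 c_G\,(a_h(v_h,v_h)+s_p(v_h,v_h))$ for all $v_h\in V_h$. 8. $s_a=s_p$ on $V_h\times V_h$. Let $f\in L^2(\Omega)$ be such that the forward solution $u$ belongs to $H^{k+1}(\Omega)$. Then there is exactly one pair $(u_h,z_h)\in V_h\times V_h$ with $$a_h(u_h,w_h)+s_a(z_h,w_h)=(f,w_h),\qquad a_h(v_h,z_h)-s_p(u_h,v_h)=-s_p(u,v_h)\qquad\forall v_h,w_h\in V_h,$$ and $$\|\nabla(u-u_h)\|\le C\,h^k\,|u|_{H^{k+1}(\Omega)},$$ where $C$ depends only on $d$, $\Omega$, $k$, $\lambda$ and the positive constants $c_{a,\Omega},c_i,c_a,c_{a,\gamma},c_G$. In particular no inverse inequality is needed: the triangulation need not be shape regular or quasi-uniform, and $C$ does not depend on it. -/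

import Mathlib

open MeasureTheory
open scoped ContDiff

noncomputable section

namespace StabFEM

/-- Euclidean space `ℝᵈ`. -/
abbrev E (d : ℕ) := EuclideanSpace ℝ (Fin d)

/-- The real Hilbert space `L²(Ω)`. -/
abbrev L2 {d : ℕ} (Ω : Set (E d)) := Lp ℝ 2 (volume.restrict Ω)

/-- Test functions: smooth functions whose support is a compact subset of `Ω`. -/
structure IsTestFunction {d : ℕ} (Ω : Set (E d)) (φ : E d → ℝ) : Prop where
  smooth : ContDiff ℝ ∞ φ
  compact : HasCompactSupport φ
  support : tsupport φ ⊆ Ω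

/-- The classical partial derivative `∂_{β 0} ⋯ ∂_{β (m-1)} φ` of order `m`. -/
def partialDeriv {d m : ℕ} (β : Fin m → Fin d) (φ : E d → ℝ) (x : E d) : ℝ :=
  iteratedFDeriv ℝ m φ x (fun i => EuclideanSpace.single (β i) 1)

/-- `g ∈ L²(Ω)` is the weak derivative `∂_{β 0} ⋯ ∂_{β (m-1)} v` on `Ω`. -/
def HasWeakDeriv {d m : ℕ} (Ω : Set (E d)) (β : Fin m → Fin d) (v g : L2 Ω) : Prop :=
  ∀ φ : E d → ℝ, IsTestFunction Ω φ →
    ∫ x in Ω, v x * partialDeriv β φ x = (-1) ^ m * ∫ x in Ω, g x * φ x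

lemma IsTestFunction.memLp_partialDeriv {d m : ℕ} {Ω : Set (E d)} {φ : E d → ℝ}
    (h : IsTestFunction Ω φ) (β : Fin m → Fin d) :
    MemLp (partialDeriv β φ) 2 (volume.restrict Ω) := by
  have hc : Continuous (iteratedFDeriv ℝ m φ) :=
    h.smooth.continuous_iteratedFDeriv (by exact_mod_cast le_top)
  have hc' : Continuous (partialDeriv β φ) := by
    exact (ContinuousMultilinearMap.apply ℝ (fun _ : Fin m => E d) ℝ
      (fun i => EuclideanSpace.single (β i) 1)).continuous.comp hc
  have hs : HasCompactSupport (partialDeriv β φ) := by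
    refine (h.compact.iteratedFDeriv (𝕜 := ℝ) m).mono' ?_
    refine subset_trans ?_ subset_closure
    intro x hx h0
    apply hx
    simp only [partialDeriv, h0]
    rfl
  exact hc'.memLp_of_hasCompactSupport hs

lemma IsTestFunction.memLp {d : ℕ} {Ω : Set (E d)} {φ : E d → ℝ}
    (h : IsTestFunction Ω φ) : MemLp φ 2 (volume.restrict Ω) :=
  h.smooth.continuous.memLp_of_hasCompactSupport h.compact

lemma integral_add_mul {d : ℕ} {Ω : Set (E d)} (v w : L2 Ω) {ψ : E d → ℝ}
    (h : MemLp ψ 2 (volume.restrict Ω)) :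
    ∫ x in Ω, (v + w : L2 Ω) x * ψ x = (∫ x in Ω, v x * ψ x) + ∫ x in Ω, w x * ψ x := by
  have hv : Integrable (fun x => v x * ψ x) (volume.restrict Ω) := (Lp.memLp v).integrable_mul h
  have hw : Integrable (fun x => w x * ψ x) (volume.restrict Ω) := (Lp.memLp w).integrable_mul h
  rw [← integral_add hv hw]
  refine integral_congr_ae ?_
  filter_upwards [Lp.coeFn_add v w] with x hx
  simp only [hx, Pi.add_apply]
  ring

lemma integral_smul_mul {d : ℕ} {Ω : Set (E d)} (c : ℝ) (v : L2 Ω) (ψ : E d → ℝ) :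
    ∫ x in Ω, (c • v : L2 Ω) x * ψ x = c * ∫ x in Ω, v x * ψ x := by
  rw [← integral_const_mul]
  refine integral_congr_ae ?_
  filter_upwards [Lp.coeFn_smul c v] with x hx
  simp only [hx, Pi.smul_apply, smul_eq_mul]
  ring

lemma HasWeakDeriv.add {d m : ℕ} {Ω : Set (E d)} {β : Fin m → Fin d} {v w g k : L2 Ω}
    (hv : HasWeakDeriv Ω β v g) (hw : HasWeakDeriv Ω β w k) :
    HasWeakDeriv Ω β (v + w) (g + k) := by
  intro φ hφ
  rw [integral_add_mul _ _ (hφ.memLp_partialDeriv β), integral_add_mul _ _ hφ.memLp,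
    hv φ hφ, hw φ hφ]
  ring

lemma HasWeakDeriv.smul {d m : ℕ} {Ω : Set (E d)} {β : Fin m → Fin d} {v g : L2 Ω} (c : ℝ)
    (hv : HasWeakDeriv Ω β v g) : HasWeakDeriv Ω β (c • v) (c • g) := by
  intro φ hφ
  rw [integral_smul_mul, integral_smul_mul, hv φ hφ]
  ring

/-- The Sobolev space `H^m(Ω)`: all weak derivatives of order at most `m` are in `L²(Ω)`. -/
def sobolev {d : ℕ} (Ω : Set (E d)) (m : ℕ) : Submodule ℝ (L2 Ω) where
  carrier := {v | ∀ j ≤ m, ∀ β : Fin j → Fin d, ∃ g : L2 Ω, HasWeakDeriv Ω β v g}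
  zero_mem' := fun j _ β => ⟨0, by
    intro φ _
    have h0 : ∀ ψ : E d → ℝ, ∫ x in Ω, (0 : L2 Ω) x * ψ x = 0 := by
      intro ψ
      simpa using integral_smul_mul (0 : ℝ) (0 : L2 Ω) ψ
    rw [h0, h0, mul_zero]⟩
  add_mem' := fun {v w} hv hw j hj β => by
    obtain ⟨g, hg⟩ := hv j hj β
    obtain ⟨k, hk⟩ := hw j hj β
    exact ⟨g + k, hg.add hk⟩
  smul_mem' := fun c v hv j hj β => by
    obtain ⟨g, hg⟩ := hv j hj β
    exact ⟨c • g, hg.smul c⟩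

open Classical in
/-- The weak derivative of `v` in the directions `β` (unique when `Ω` is open);
`0` if there is none in `L²(Ω)`. -/
def weakDeriv {d m : ℕ} (Ω : Set (E d)) (β : Fin m → Fin d) (v : L2 Ω) : L2 Ω :=
  if h : ∃ g : L2 Ω, HasWeakDeriv Ω β v g then h.choose else 0

/-- The seminorm `|v|_{H^m(Ω)} = ‖D^m v‖` for `v ∈ H^m(Ω)`, with the Euclidean norm of the tensor
of all derivatives of order `m`. -/
def seminormH {d : ℕ} (Ω : Set (E d)) (m : ℕ) (v : L2 Ω) : ℝ :=
  Real.sqrt (∑ β : Fin m → Fin d, ‖weakDeriv Ω β v‖ ^ 2)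

/-- The gradient norm `‖∇ v‖` in `L²(Ω)`. -/
def gradNorm {d : ℕ} (Ω : Set (E d)) (v : L2 Ω) : ℝ := seminormH Ω 1 v

/-- A conforming triangulation of `Ω ⊆ ℝᵈ`: a finite, purely `d`-dimensional simplicial complex
with union `closure Ω`, the open cells of which lie in `Ω`. An open set that has one is polygonal
(`d = 2`) or polyhedral (`d = 3`). -/
structure Triangulation {d : ℕ} (Ω : Set (E d)) where
  complex : Geometry.SimplicialComplex ℝ (E d)
  finite : complex.faces.Finite
  pure : ∀ s ∈ complex.faces, ∃ t ∈ complex.faces, s ⊆ t ∧ t.card = d + 1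
  space_eq : complex.space = closure Ω
  interior_subset : ∀ s ∈ complex.faces, interior (convexHull ℝ (s : Set (E d))) ⊆ Ω

/-- The (closed) cells `K` of a triangulation. -/
def Triangulation.cells {d : ℕ} {Ω : Set (E d)} (T : Triangulation Ω) : Set (Set (E d)) :=
  {K | ∃ s ∈ T.complex.faces, s.card = d + 1 ∧ K = convexHull ℝ (s : Set (E d))}

/-- The mesh size `h = max_K diam K`. -/
def Triangulation.meshSize {d : ℕ} {Ω : Set (E d)} (T : Triangulation Ω) : ℝ :=
  sSup (Metric.diam '' T.cells)

/-- The finite element space `X_h^k = {v ∈ H¹(Ω) : v|_K ∈ P_k(K) for all cells K}`. -/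
def Triangulation.feSpace {d : ℕ} {Ω : Set (E d)} (T : Triangulation Ω) (k : ℕ) :
    Submodule ℝ (L2 Ω) where
  carrier := {v | v ∈ sobolev Ω 1 ∧ ∀ K ∈ T.cells, ∃ p : MvPolynomial (Fin d) ℝ,
    p.totalDegree ≤ k ∧ ∀ᵐ x ∂volume.restrict Ω, x ∈ K → v x = MvPolynomial.eval (fun i => x i) p}
  zero_mem' := by
    refine ⟨Submodule.zero_mem _, fun K _ => ⟨0, by simp, ?_⟩⟩
    filter_upwards [Lp.coeFn_zero ℝ 2 (volume.restrict Ω)] with x hx _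
    simpa using hx
  add_mem' := by
    rintro v w ⟨hv, hv'⟩ ⟨hw, hw'⟩
    refine ⟨Submodule.add_mem _ hv hw, fun K hK => ?_⟩
    obtain ⟨p, hp, hpv⟩ := hv' K hK
    obtain ⟨q, hq, hqw⟩ := hw' K hK
    refine ⟨p + q, (MvPolynomial.totalDegree_add p q).trans (max_le hp hq), ?_⟩
    filter_upwards [hpv, hqw, Lp.coeFn_add v w] with x h1 h2 h3 hxK
    rw [h3, Pi.add_apply, h1 hxK, h2 hxK, map_add]
  smul_mem' := by
    rintro c v ⟨hv, hv'⟩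
    refine ⟨Submodule.smul_mem _ c hv, fun K hK => ?_⟩
    obtain ⟨p, hp, hpv⟩ := hv' K hK
    refine ⟨c • p, (MvPolynomial.totalDegree_smul_le c p).trans hp, ?_⟩
    filter_upwards [hpv, Lp.coeFn_smul c v] with x h1 h3 hxK
    rw [h3, Pi.smul_apply, h1 hxK, MvPolynomial.smul_eval, smul_eq_mul]

/-- `b` restricts to a bilinear form on `A × B`; its values elsewhere are irrelevant. -/
structure IsBilinOn {H : Type*} [AddCommGroup H] [Module ℝ H] (A B : Submodule ℝ H)
    (b : H → H → ℝ) : Prop where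
  add_left : ∀ x ∈ A, ∀ x' ∈ A, ∀ y ∈ B, b (x + x') y = b x y + b x' y
  smul_left : ∀ (c : ℝ), ∀ x ∈ A, ∀ y ∈ B, b (c • x) y = c * b x y
  add_right : ∀ x ∈ A, ∀ y ∈ B, ∀ y' ∈ B, b x (y + y') = b x y + b x y'
  smul_right : ∀ (c : ℝ), ∀ x ∈ A, ∀ y ∈ B, b x (c • y) = c * b x y

/-- `s` restricts to a symmetric positive semi-definite bilinear form on `A`. -/
structure IsStabilisationOn {H : Type*} [AddCommGroup H] [Module ℝ H] (A : Submodule ℝ H)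
    (s : H → H → ℝ) : Prop where
  bilin : IsBilinOn A A s
  symm : ∀ x ∈ A, ∀ y ∈ A, s x y = s y x
  nonneg : ∀ x ∈ A, 0 ≤ s x x

/-- The seminorm `|x|_S = s(x,x)^{1/2}` induced by a stabilisation form. -/
def stabNorm {H : Type*} (s : H → H → ℝ) (x : H) : ℝ := Real.sqrt (s x x)

/-- `N` restricts to a seminorm on `A`. -/
structure IsSeminormOn {H : Type*} [AddCommGroup H] [Module ℝ H] (A : Submodule ℝ H)
    (N : H → ℝ) : Prop where
  nonneg : ∀ x ∈ A, 0 ≤ N x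
  add_le : ∀ x ∈ A, ∀ y ∈ A, N (x + y) ≤ N x + N y
  smul : ∀ (c : ℝ), ∀ x ∈ A, N (c • x) = |c| * N x

/-- `u ∈ V` is a weak solution of the forward problem `a(u,w) = (f,w)` for all `w ∈ W`. -/
def SolvesForward {d : ℕ} {Ω : Set (E d)} (V W : Submodule ℝ (L2 Ω)) (a : L2 Ω → L2 Ω → ℝ)
    (f u : L2 Ω) : Prop :=
  u ∈ V ∧ ∀ w ∈ W, a u w = inner ℝ f w

/-- `z ∈ W` is a weak solution of the adjoint problem `a(v,z) = (g,v)` for all `v ∈ V`. -/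
def SolvesAdjoint {d : ℕ} {Ω : Set (E d)} (V W : Submodule ℝ (L2 Ω)) (a : L2 Ω → L2 Ω → ℝ)
    (g z : L2 Ω) : Prop :=
  z ∈ W ∧ ∀ v ∈ V, a v z = inner ℝ g v

/-- `(u_h, z_h) ∈ V_h × V_h` solves the stabilised finite element method
`a_h(u_h,w_h) + s_a(z_h,w_h) = (f,w_h)`, `a_h(v_h,z_h) - s_p(u_h,v_h) = -s_p(u,v_h)`. -/
structure SolvesFEM {d : ℕ} {Ω : Set (E d)} (Vh : Submodule ℝ (L2 Ω))
    (ah sa sp : L2 Ω → L2 Ω → ℝ) (f u uh zh : L2 Ω) : Prop where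
  primal_mem : uh ∈ Vh
  dual_mem : zh ∈ Vh
  primal : ∀ wh ∈ Vh, ah uh wh + sa zh wh = inner ℝ f wh
  dual : ∀ vh ∈ Vh, ah vh zh - sp uh vh = -sp u vh

end StabFEM

end

/-!
The errors are controlled by testing the two discrete equations with `(u_h - π_V u, z_h)`: this
bounds the stabilisation seminorms `|u - u_h|_{S_p}` and `|z_h|_{S_a}` by the approximation error
of `u`, up to the perturbation `ε ‖z_h‖`. The forward problem with data `z_h` bounds `‖z_h‖` by the
same seminorms with an additional factor `h`, and since `h ε` is small the perturbation is absorbed.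
The adjoint problem with data `u - u_h` bounds `‖u - u_h‖` in the same way. These bounds
make the homogeneous discrete problem uniquely solvable, hence every discrete problem, and they
bound the right-hand side of the Gårding inequality at `u_h - π_V u`. The only critical term there
is `ε ‖u_h - π_V u‖`; its factor `ε` is compensated by the factor `h` of the `L²` estimate, which is
where other arguments use an inverse inequality.
-/

namespace StabFEM

section StabilisationForms

variable {H : Type*} [AddCommGroup H] [Module ℝ H] {A B : Submodule ℝ H} {b s : H → H → ℝ}
  {x x' y y' : H}

lemma IsBilinOn.mono {A' B' : Submodule ℝ H} (hb : IsBilinOn A B b) (hA : A' ≤ A) (hB : B' ≤ B) :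
    IsBilinOn A' B' b where
  add_left x hx x' hx' y hy := hb.add_left x (hA hx) x' (hA hx') y (hB hy)
  smul_left c x hx y hy := hb.smul_left c x (hA hx) y (hB hy)
  add_right x hx y hy y' hy' := hb.add_right x (hA hx) y (hB hy) y' (hB hy')
  smul_right c x hx y hy := hb.smul_right c x (hA hx) y (hB hy)

/-- The bilinear map `A × B → ℝ` given by a form that is bilinear on `A × B`; it gives access to
the library's linear algebra. -/
def IsBilinOn.toLinearMap₂ (hb : IsBilinOn A B b) : A →ₗ[ℝ] B →ₗ[ℝ] ℝ :=
  LinearMap.mk₂ ℝ (fun x y => b x y)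
    (fun x x' y => hb.add_left x x.2 x' x'.2 y y.2)
    (fun c x y => hb.smul_left c x x.2 y y.2)
    (fun x y y' => hb.add_right x x.2 y y.2 y' y'.2)
    (fun c x y => hb.smul_right c x x.2 y y.2)

lemma IsBilinOn.zero_left (hb : IsBilinOn A B b) (hy : y ∈ B) : b 0 y = 0 :=
  LinearMap.map_zero₂ hb.toLinearMap₂ ⟨y, hy⟩

lemma IsBilinOn.sub_left (hb : IsBilinOn A B b) (hx : x ∈ A) (hx' : x' ∈ A) (hy : y ∈ B) :
    b (x - x') y = b x y - b x' y :=
  LinearMap.map_sub₂ hb.toLinearMap₂ ⟨x, hx⟩ ⟨x', hx'⟩ ⟨y, hy⟩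

lemma IsBilinOn.sub_right (hb : IsBilinOn A B b) (hx : x ∈ A) (hy : y ∈ B) (hy' : y' ∈ B) :
    b x (y - y') = b x y - b x y' :=
  map_sub (hb.toLinearMap₂ ⟨x, hx⟩) ⟨y, hy⟩ ⟨y', hy'⟩

lemma IsStabilisationOn.mono {A' : Submodule ℝ H} (hs : IsStabilisationOn A s) (hA : A' ≤ A) :
    IsStabilisationOn A' s where
  bilin := hs.bilin.mono hA hA
  symm x hx y hy := hs.symm x (hA hx) y (hA hy)
  nonneg x hx := hs.nonneg x (hA hx)

lemma stabNorm_nonneg {H : Type*} (s : H → H → ℝ) (x : H) : 0 ≤ stabNorm s x :=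
  Real.sqrt_nonneg _

lemma IsStabilisationOn.sq_stabNorm (hs : IsStabilisationOn A s) (hx : x ∈ A) :
    stabNorm s x ^ 2 = s x x :=
  Real.sq_sqrt (hs.nonneg x hx)

lemma IsStabilisationOn.abs_le_stabNorm_mul_stabNorm (hs : IsStabilisationOn A s) (hx : x ∈ A)
    (hy : y ∈ A) : |s x y| ≤ stabNorm s x * stabNorm s y := by
  rw [stabNorm, stabNorm, ← Real.sqrt_mul (hs.nonneg x hx)]
  exact Real.abs_le_sqrt <| LinearMap.BilinForm.apply_sq_le_of_symm hs.bilin.toLinearMap₂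
    (fun v => hs.nonneg v v.2) ⟨fun v w => hs.symm v v.2 w w.2⟩ ⟨x, hx⟩ ⟨y, hy⟩

lemma IsStabilisationOn.le_stabNorm_mul_stabNorm (hs : IsStabilisationOn A s) (hx : x ∈ A)
    (hy : y ∈ A) : s x y ≤ stabNorm s x * stabNorm s y :=
  (le_abs_self _).trans (hs.abs_le_stabNorm_mul_stabNorm hx hy)

lemma IsStabilisationOn.neg_le_stabNorm_mul_stabNorm (hs : IsStabilisationOn A s) (hx : x ∈ A)
    (hy : y ∈ A) : -s x y ≤ stabNorm s x * stabNorm s y :=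
  (neg_le_abs _).trans (hs.abs_le_stabNorm_mul_stabNorm hx hy)

lemma IsStabilisationOn.stabNorm_sub_le (hs : IsStabilisationOn A s) (hx : x ∈ A) (hy : y ∈ A) :
    stabNorm s (x - y) ≤ stabNorm s x + stabNorm s y := by
  have hxy : x - y ∈ A := sub_mem hx hy
  refine Real.sqrt_le_iff.2 ⟨add_nonneg (stabNorm_nonneg s x) (stabNorm_nonneg s y), ?_⟩
  calc s (x - y) (x - y) = stabNorm s x ^ 2 - 2 * s x y + stabNorm s y ^ 2 := by
        rw [hs.bilin.sub_left hx hy hxy, hs.bilin.sub_right hx hx hy, hs.bilin.sub_right hy hx hy,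
          hs.symm y hy x hx, hs.sq_stabNorm hx, hs.sq_stabNorm hy]
        ring
    _ ≤ (stabNorm s x + stabNorm s y) ^ 2 := by
        linarith [hs.neg_le_stabNorm_mul_stabNorm hx hy]

end StabilisationForms

lemma existsUnique_saddlePoint {K X : Type*} [Field K] [AddCommGroup X] [Module K X]
    [FiniteDimensional K X] (a s t : X →ₗ[K] X →ₗ[K] K)
    (hom : ∀ x y, (∀ w, a x w + s y w = 0) → (∀ v, a v y - t x v = 0) → x = 0 ∧ y = 0)
    (F G : Module.Dual K X) :
    ∃! p : X × X, (∀ w, a p.1 w + s p.2 w = F w) ∧ ∀ v, a v p.2 - t p.1 v = G v := by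
  let L : X × X →ₗ[K] Module.Dual K X × Module.Dual K X :=
    (a.coprod s).prod ((-t).coprod a.flip)
  have L_eq_iff (p : X × X) (F G : Module.Dual K X) :
      L p = (F, G) ↔ (∀ w, a p.1 w + s p.2 w = F w) ∧ ∀ v, a v p.2 - t p.1 v = G v := by
    simp [L, Prod.ext_iff, LinearMap.ext_iff, neg_add_eq_sub]
  have injective : Function.Injective L := by
    refine (injective_iff_map_eq_zero L).2 fun p hp => ?_
    obtain ⟨h₁, h₂⟩ := (L_eq_iff p 0 0).1 hp
    exact Prod.ext_iff.2 (hom p.1 p.2 h₁ h₂)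
  have bijective : Function.Bijective L :=
    ⟨injective, (LinearMap.injective_iff_surjective_of_finrank_eq_finrank
      (by simp [Module.finrank_prod, Subspace.dual_finrank_eq])).1 injective⟩
  simpa only [L_eq_iff] using bijective.existsUnique (F, G)

/-- Absorption: a term `ε * x` on the right-hand side of a duality estimate of rate `δ` is harmless
when `δ * ε` is small. -/
lemma le_of_sq_le_mul_add {x r δ ε : ℝ} (hx : 0 ≤ x) (hr : 0 ≤ r) (hδ : 0 ≤ δ)
    (small : δ * ε ≤ 1 / 6) (h : x ^ 2 ≤ δ * x * (r + ε * x)) : x ≤ 6 / 5 * δ * r := by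
  obtain rfl | hx := hx.eq_or_lt
  · positivity
  have : x ≤ δ * (r + ε * x) := le_of_mul_le_mul_left (by linarith) hx
  linarith [mul_le_mul_of_nonneg_right small hx.le]

/-- The constant of the estimate for the stabilisation seminorms of the discrete errors. -/
noncomputable def stabConst (ca : ℝ) : ℝ := 12 / 5 * (ca + 1) + 1

/-- The constant of the estimate of the error in the norm of the Hilbert space, `L²(Ω)` in the
application. -/
noncomputable def l2Const (ca : ℝ) : ℝ := 6 / 5 * (ca + (ca + 1) * stabConst ca)

/-- The constant that the Gårding inequality (with constants `cG` and `lam`) gives for the square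
of the discrete error in the energy norm. -/
noncomputable def energyConst (ca cG lam δ : ℝ) : ℝ :=
  |lam| * ((l2Const ca + 1) * δ) ^ 2 +
    cG * (stabConst ca * (stabConst ca + ca) + (l2Const ca + 1) / 6)

lemma stabConst_pos {ca : ℝ} (hca : 0 ≤ ca) : 0 < stabConst ca := by
  rw [stabConst]
  positivity

lemma l2Const_nonneg {ca : ℝ} (hca : 0 ≤ ca) : 0 ≤ l2Const ca := by
  have := stabConst_pos hca
  rw [l2Const]
  positivity

lemma energyConst_le_energyConst {ca cG lam δ δ' : ℝ} (hca : 0 ≤ ca) (hδ : 0 ≤ δ) (h : δ ≤ δ') :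
    energyConst ca cG lam δ ≤ energyConst ca cG lam δ' := by
  have := l2Const_nonneg hca
  unfold energyConst
  gcongr

/-- A primal-dual stabilised Galerkin method in a Hilbert space `H`, with the properties that its
error analysis uses. The spaces `V₂`, `W₂` and `Vₖ` consist of the regular primal and dual functions
and of the primal functions on which the primal stabilisation is consistent. The continuous
problems enter through the approximability, at the rate `δ`, of their solutions with data `g`. -/
structure StabilisedGalerkinMethod (H : Type*) [NormedAddCommGroup H] [InnerProductSpace ℝ H] where
  V₂ : Submodule ℝ H
  W₂ : Submodule ℝ H
  Vₖ : Submodule ℝ H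
  Vh : Submodule ℝ H
  ah : H → H → ℝ
  sa : H → H → ℝ
  sp : H → H → ℝ
  πV : H → H
  πW : H → H
  Nplus : H → ℝ
  Nstar : H → ℝ
  NL : H → ℝ
  ca : ℝ
  δ : ℝ
  ε : ℝ
  Vₖ_le : Vₖ ≤ V₂
  bilin : IsBilinOn (V₂ ⊔ Vh) (W₂ ⊔ Vh) ah
  stab_primal : IsStabilisationOn (Vₖ ⊔ Vh) sp
  stab_dual : IsStabilisationOn Vh sa
  stab_eq : ∀ v ∈ Vh, ∀ w ∈ Vh, sa v w = sp v w
  πV_mem : ∀ v ∈ V₂, πV v ∈ Vh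
  πW_mem : ∀ w ∈ W₂, πW w ∈ Vh
  Nplus_nonneg : ∀ v ∈ V₂ ⊔ Vh, 0 ≤ Nplus v
  NL_nonneg : ∀ v ∈ V₂ ⊔ Vh, 0 ≤ NL v
  forward : ∀ g, ∃ φ ∈ V₂, (∀ w ∈ Vh, ah φ w = inner ℝ g w) ∧
    Nplus (φ - πV φ) ≤ δ * ‖g‖ ∧ stabNorm sp (πV φ) ≤ δ * ‖g‖
  adjoint : ∀ g, ∃ ζ ∈ W₂, (∀ v ∈ V₂ ⊔ Vh, ah v ζ = inner ℝ v g) ∧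
    Nstar (ζ - πW ζ) ≤ δ * ‖g‖ ∧ stabNorm sa (πW ζ) ≤ δ * ‖g‖
  continuous_left : ∀ v ∈ V₂, ∀ x ∈ Vh,
    ah (v - πV v) x ≤ Nplus (v - πV v) * (ca * stabNorm sa x + ε * ‖x‖)
  continuous_right : ∀ v ∈ V₂, ∀ vh ∈ Vh, ∀ y ∈ W₂,
    ah (v - vh) (y - πW y) ≤
      Nstar (y - πW y) * (ca * NL (v - πV v) + ca * stabNorm sp (vh - πV v) + ε * ‖v - vh‖)
  ca_nonneg : 0 ≤ ca
  δ_nonneg : 0 ≤ δ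
  ε_nonneg : 0 ≤ ε
  small : δ * ε ≤ 1 / 6

namespace StabilisedGalerkinMethod

variable {H : Type*} [NormedAddCommGroup H] [InnerProductSpace ℝ H]
  (S : StabilisedGalerkinMethod H) {u uh zh : H}

/-- The error of the interpolant of `v` in the three seminorms that govern the consistency of the
method. -/
noncomputable def approxError (v : H) : ℝ :=
  S.NL (v - S.πV v) + S.Nplus (v - S.πV v) + stabNorm S.sp (v - S.πV v)

/-- `(uh, zh)` is the discrete solution of the method whose exact primal solution is `u` and whose
exact dual solution is `0`. The data of the continuous problem are expressed by `u`, using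
consistency. -/
structure IsDiscreteSolution (u uh zh : H) : Prop where
  primal_mem : uh ∈ S.Vh
  dual_mem : zh ∈ S.Vh
  primal : ∀ w ∈ S.Vh, S.ah uh w + S.sa zh w = S.ah u w
  dual : ∀ v ∈ S.Vh, S.ah v zh - S.sp uh v = -S.sp u v

variable {S}

lemma sub_πV_mem (hu : u ∈ S.Vₖ) : u - S.πV u ∈ S.Vₖ ⊔ S.Vh :=
  Submodule.sub_mem_sup hu (S.πV_mem u (S.Vₖ_le hu))

lemma Vₖ_sup_Vh_le : S.Vₖ ⊔ S.Vh ≤ S.V₂ ⊔ S.Vh := sup_le_sup_right S.Vₖ_le _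

lemma Nplus_le_approxError (hu : u ∈ S.Vₖ) : S.Nplus (u - S.πV u) ≤ S.approxError u := by
  rw [approxError]
  linarith [S.NL_nonneg _ (Vₖ_sup_Vh_le (sub_πV_mem hu)), stabNorm_nonneg S.sp (u - S.πV u)]

lemma NL_add_stabNorm_le_approxError (hu : u ∈ S.Vₖ) :
    S.NL (u - S.πV u) + stabNorm S.sp (u - S.πV u) ≤ S.approxError u := by
  rw [approxError]
  linarith [S.Nplus_nonneg _ (Vₖ_sup_Vh_le (sub_πV_mem hu))]

lemma stabNorm_le_approxError (hu : u ∈ S.Vₖ) :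
    stabNorm S.sp (u - S.πV u) ≤ S.approxError u := by
  linarith [NL_add_stabNorm_le_approxError hu, S.NL_nonneg _ (Vₖ_sup_Vh_le (sub_πV_mem hu))]

lemma approxError_nonneg (hu : u ∈ S.Vₖ) : 0 ≤ S.approxError u :=
  (stabNorm_nonneg _ _).trans (stabNorm_le_approxError hu)

lemma ah_sub_πV_le (hu : u ∈ S.Vₖ) {x : H} (hx : x ∈ S.Vh) :
    S.ah (u - S.πV u) x ≤ S.approxError u * (S.ca * stabNorm S.sa x + S.ε * ‖x‖) := by
  have hca := S.ca_nonneg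
  have hε := S.ε_nonneg
  have hx_nonneg := stabNorm_nonneg S.sa x
  exact (S.continuous_left u (S.Vₖ_le hu) x hx).trans
    (mul_le_mul_of_nonneg_right (Nplus_le_approxError hu) (by positivity))

namespace IsDiscreteSolution

variable (h : S.IsDiscreteSolution u uh zh) (hu : u ∈ S.Vₖ)
include h hu

lemma error_mem : u - uh ∈ S.Vₖ ⊔ S.Vh := Submodule.sub_mem_sup hu h.primal_mem

lemma discreteError_mem : uh - S.πV u ∈ S.Vh :=
  sub_mem h.primal_mem (S.πV_mem u (S.Vₖ_le hu))

lemma ah_error {w : H} (hw : w ∈ S.Vh) : S.ah (u - uh) w = S.sa zh w := by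
  rw [S.bilin.sub_left (Submodule.mem_sup_left (S.Vₖ_le hu))
    (Submodule.mem_sup_right h.primal_mem) (Submodule.mem_sup_right hw)]
  linarith [h.primal w hw]

lemma ah_dual {v : H} (hv : v ∈ S.Vh) : S.ah v zh = -S.sp (u - uh) v := by
  rw [S.stab_primal.bilin.sub_left (Submodule.mem_sup_left hu)
    (Submodule.mem_sup_right h.primal_mem) (Submodule.mem_sup_right hv)]
  linarith [h.dual v hv]

lemma ah_discreteError {w : H} (hw : w ∈ S.Vh) :
    S.ah (uh - S.πV u) w = S.ah (u - S.πV u) w - S.sa zh w := by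
  rw [← sub_sub_sub_cancel_left, S.bilin.sub_left (Vₖ_sup_Vh_le (sub_πV_mem hu))
    (Vₖ_sup_Vh_le (h.error_mem hu)) (Submodule.mem_sup_right hw), h.ah_error hu hw]

lemma norm_dual_le :
    ‖zh‖ ≤ 6 / 5 * S.δ * (S.ca * stabNorm S.sa zh + stabNorm S.sp (u - uh)) := by
  have hca := S.ca_nonneg
  have hε := S.ε_nonneg
  have hδ := S.δ_nonneg
  have hz := stabNorm_nonneg S.sa zh
  have he := stabNorm_nonneg S.sp (u - uh)
  obtain ⟨φ, hφ, forward, Nplus_le, stab_le⟩ := S.forward zh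
  have hπφ := S.πV_mem φ hφ
  have duality : ‖zh‖ ^ 2 = S.ah (φ - S.πV φ) zh - S.sp (u - uh) (S.πV φ) := by
    rw [S.bilin.sub_left (Submodule.mem_sup_left hφ) (Submodule.mem_sup_right hπφ)
      (Submodule.mem_sup_right h.dual_mem), forward zh h.dual_mem, h.ah_dual hu hπφ,
      real_inner_self_eq_norm_sq]
    ring
  have form_le : S.ah (φ - S.πV φ) zh ≤ S.δ * ‖zh‖ * (S.ca * stabNorm S.sa zh + S.ε * ‖zh‖) :=
    (S.continuous_left φ hφ zh h.dual_mem).trans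
      (mul_le_mul_of_nonneg_right Nplus_le (by positivity))
  have stab_form_le : -S.sp (u - uh) (S.πV φ) ≤ stabNorm S.sp (u - uh) * (S.δ * ‖zh‖) :=
    (S.stab_primal.neg_le_stabNorm_mul_stabNorm (h.error_mem hu)
      (Submodule.mem_sup_right hπφ)).trans (mul_le_mul_of_nonneg_left stab_le he)
  exact le_of_sq_le_mul_add (norm_nonneg zh) (by positivity) hδ S.small (by linarith)

lemma sq_stabNorm_add_sq_stabNorm :
    stabNorm S.sp (u - uh) ^ 2 + stabNorm S.sa zh ^ 2 =
      S.ah (u - S.πV u) zh + S.sp (u - uh) (u - S.πV u) := by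
  have primal := h.ah_discreteError hu h.dual_mem
  have dual := h.ah_dual hu (h.discreteError_mem hu)
  have sp_discreteError : S.sp (u - uh) (uh - S.πV u) =
      S.sp (u - uh) (u - S.πV u) - S.sp (u - uh) (u - uh) := by
    rw [← S.stab_primal.bilin.sub_right (h.error_mem hu) (sub_πV_mem hu) (h.error_mem hu),
      sub_sub_sub_cancel_left]
  rw [S.stab_primal.sq_stabNorm (h.error_mem hu), S.stab_dual.sq_stabNorm h.dual_mem]
  linarith

lemma stabNorm_error_add_le :
    stabNorm S.sp (u - uh) + stabNorm S.sa zh ≤ 12 / 5 * (S.ca + 1) * S.approxError u := by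
  have hca := S.ca_nonneg
  have hM := approxError_nonneg hu
  have energy := h.sq_stabNorm_add_sq_stabNorm hu
  have form_le := ah_sub_πV_le hu h.dual_mem
  have stab_form_le := (S.stab_primal.le_stabNorm_mul_stabNorm (h.error_mem hu)
    (sub_πV_mem hu)).trans (mul_le_mul_of_nonneg_left (stabNorm_le_approxError hu)
      (stabNorm_nonneg S.sp (u - uh)))
  have dual_le := mul_le_mul_of_nonneg_left (h.norm_dual_le hu) S.ε_nonneg
  have he := stabNorm_nonneg S.sp (u - uh)
  have hz := stabNorm_nonneg S.sa zh
  set q := stabNorm S.sp (u - uh)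
  set a := stabNorm S.sa zh
  set M := S.approxError u
  have perturbation_le : S.ε * ‖zh‖ ≤ 1 / 5 * (S.ca * a + q) := by
    linarith [mul_le_mul_of_nonneg_right S.small (show 0 ≤ S.ca * a + q by positivity)]
  have sq_le : q ^ 2 + a ^ 2 ≤ 6 / 5 * (S.ca + 1) * M * (q + a) := by
    calc q ^ 2 + a ^ 2 ≤ M * (S.ca * a + 1 / 5 * (S.ca * a + q)) + q * M := by
          linarith [mul_le_mul_of_nonneg_left perturbation_le hM]
      _ = 6 / 5 * (S.ca * (M * a) + M * q) := by ring
      _ ≤ 6 / 5 * ((S.ca + 1) * (M * a) + (S.ca + 1) * (M * q)) := by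
          linarith [mul_nonneg hM hz, mul_nonneg hca (mul_nonneg hM he)]
      _ = 6 / 5 * (S.ca + 1) * M * (q + a) := by ring
  have sq_add_le : (q + a) ^ 2 ≤ 12 / 5 * (S.ca + 1) * M * (q + a) := by
    linarith [add_sq_le (a := q) (b := a)]
  obtain hqa | hqa := (add_nonneg he hz).eq_or_lt
  · rw [← hqa]
    positivity
  · exact le_of_mul_le_mul_right (by linarith) hqa

lemma stabNorm_discreteError_add_le :
    stabNorm S.sp (uh - S.πV u) + stabNorm S.sa zh ≤ stabConst S.ca * S.approxError u := by
  have triangle := S.stab_primal.stabNorm_sub_le (sub_πV_mem hu) (h.error_mem hu)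
  rw [sub_sub_sub_cancel_left] at triangle
  rw [stabConst]
  linarith [h.stabNorm_error_add_le hu, stabNorm_le_approxError hu]

lemma NL_add_stabNorm_add_stabNorm_le :
    S.ca * S.NL (u - S.πV u) + S.ca * stabNorm S.sp (uh - S.πV u) + stabNorm S.sa zh ≤
      (S.ca + (S.ca + 1) * stabConst S.ca) * S.approxError u := by
  have hca := S.ca_nonneg
  have NL_le : S.NL (u - S.πV u) ≤ S.approxError u := by
    linarith [NL_add_stabNorm_le_approxError hu, stabNorm_nonneg S.sp (u - S.πV u)]
  have ca_NL_le := mul_le_mul_of_nonneg_left NL_le hca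
  have stab_le := mul_le_mul_of_nonneg_left (h.stabNorm_discreteError_add_le hu)
    (show 0 ≤ S.ca + 1 by positivity)
  linarith [mul_nonneg hca (stabNorm_nonneg S.sa zh), stabNorm_nonneg S.sp (uh - S.πV u)]

lemma norm_error_le : ‖u - uh‖ ≤ l2Const S.ca * S.δ * S.approxError u := by
  have hca := S.ca_nonneg
  have hε := S.ε_nonneg
  have hδ := S.δ_nonneg
  have hz := stabNorm_nonneg S.sa zh
  have hξ := stabNorm_nonneg S.sp (uh - S.πV u)
  have hNL := S.NL_nonneg _ (Vₖ_sup_Vh_le (sub_πV_mem hu))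
  have error_mem := Vₖ_sup_Vh_le (h.error_mem hu)
  obtain ⟨ζ, hζ, adjoint, Nstar_le, stab_le⟩ := S.adjoint (u - uh)
  have hπζ := S.πW_mem ζ hζ
  set r := S.ca * S.NL (u - S.πV u) + S.ca * stabNorm S.sp (uh - S.πV u)
  have duality : ‖u - uh‖ ^ 2 = S.ah (u - uh) (ζ - S.πW ζ) + S.sa zh (S.πW ζ) := by
    rw [S.bilin.sub_right error_mem (Submodule.mem_sup_left hζ) (Submodule.mem_sup_right hπζ),
      adjoint _ error_mem, h.ah_error hu hπζ, real_inner_self_eq_norm_sq]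
    ring
  have form_le : S.ah (u - uh) (ζ - S.πW ζ) ≤ S.δ * ‖u - uh‖ * (r + S.ε * ‖u - uh‖) :=
    (S.continuous_right u (S.Vₖ_le hu) uh h.primal_mem ζ hζ).trans
      (mul_le_mul_of_nonneg_right Nstar_le (by positivity))
  have stab_form_le : S.sa zh (S.πW ζ) ≤ stabNorm S.sa zh * (S.δ * ‖u - uh‖) :=
    (S.stab_dual.le_stabNorm_mul_stabNorm h.dual_mem hπζ).trans
      (mul_le_mul_of_nonneg_left stab_le hz)
  have error_le : ‖u - uh‖ ≤ 6 / 5 * S.δ * (r + stabNorm S.sa zh) :=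
    le_of_sq_le_mul_add (norm_nonneg _) (by positivity) hδ S.small (by linarith)
  have r_le := h.NL_add_stabNorm_add_stabNorm_le hu
  calc ‖u - uh‖ ≤ 6 / 5 * S.δ * ((S.ca + (S.ca + 1) * stabConst S.ca) * S.approxError u) := by
        refine error_le.trans ?_
        gcongr
    _ = l2Const S.ca * S.δ * S.approxError u := by
        rw [l2Const]
        ring

lemma ah_add_sp_discreteError_le :
    S.ah (uh - S.πV u) (uh - S.πV u) + S.sp (uh - S.πV u) (uh - S.πV u) ≤
      stabConst S.ca * (stabConst S.ca + S.ca) * S.approxError u ^ 2 +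
        S.approxError u * (S.ε * ‖uh - S.πV u‖) := by
  have hca := S.ca_nonneg
  have hM := approxError_nonneg hu
  have ξ_mem := h.discreteError_mem hu
  have stab_le := h.stabNorm_discreteError_add_le hu
  have stabNorm_eq : stabNorm S.sa (uh - S.πV u) = stabNorm S.sp (uh - S.πV u) := by
    rw [stabNorm, stabNorm, S.stab_eq _ ξ_mem _ ξ_mem]
  have form_eq := h.ah_discreteError hu ξ_mem
  have form_le := ah_sub_πV_le hu ξ_mem
  have stab_form_le := S.stab_dual.neg_le_stabNorm_mul_stabNorm h.dual_mem ξ_mem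
  rw [stabNorm_eq] at form_le stab_form_le
  rw [← S.stab_primal.sq_stabNorm (Submodule.mem_sup_right ξ_mem), form_eq]
  have hz := stabNorm_nonneg S.sa zh
  have hξ := stabNorm_nonneg S.sp (uh - S.πV u)
  set p := stabNorm S.sp (uh - S.πV u)
  set a := stabNorm S.sa zh
  set M := S.approxError u
  have hp : p ≤ stabConst S.ca * M := by linarith
  have hK : 0 ≤ stabConst S.ca * M := hξ.trans hp
  calc S.ah (u - S.πV u) (uh - S.πV u) - S.sa zh (uh - S.πV u) + p ^ 2
      ≤ (p + a) * p + M * S.ca * p + M * (S.ε * ‖uh - S.πV u‖) := by linarith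
    _ ≤ stabConst S.ca * M * (stabConst S.ca * M) + M * S.ca * (stabConst S.ca * M) +
          M * (S.ε * ‖uh - S.πV u‖) := by gcongr
    _ = _ := by ring

lemma norm_discreteError_le {M : ℝ} (hM : S.approxError u ≤ M) (hη : ‖u - S.πV u‖ ≤ S.δ * M) :
    ‖uh - S.πV u‖ ≤ (l2Const S.ca + 1) * S.δ * M := by
  have hδ := S.δ_nonneg
  have hK := l2Const_nonneg S.ca_nonneg
  calc ‖uh - S.πV u‖ ≤ ‖u - S.πV u‖ + ‖u - uh‖ := by
        rw [← sub_sub_sub_cancel_left]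
        exact norm_sub_le _ _
    _ ≤ S.δ * M + l2Const S.ca * S.δ * M :=
        add_le_add hη ((h.norm_error_le hu).trans (by gcongr))
    _ = (l2Const S.ca + 1) * S.δ * M := by ring

lemma sq_discreteError_le_of_garding {N : H → ℝ} {cG lam M : ℝ} (hcG : 0 ≤ cG)
    (garding : ∀ x ∈ S.Vh, N x ^ 2 - lam * ‖x‖ ^ 2 ≤ cG * (S.ah x x + S.sp x x))
    (hM : S.approxError u ≤ M) (hη : ‖u - S.πV u‖ ≤ S.δ * M) :
    N (uh - S.πV u) ^ 2 ≤ energyConst S.ca cG lam S.δ * M ^ 2 := by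
  have hca := S.ca_nonneg
  have hε := S.ε_nonneg
  have hE := approxError_nonneg hu
  have hK := l2Const_nonneg S.ca_nonneg
  have hK' := stabConst_pos S.ca_nonneg
  have hM₀ : 0 ≤ M := hE.trans hM
  have ξ_le := h.norm_discreteError_le hu hM hη
  set ξ := uh - S.πV u
  have lower_order_le : lam * ‖ξ‖ ^ 2 ≤ |lam| * ((l2Const S.ca + 1) * S.δ * M) ^ 2 := by
    gcongr
    exact le_abs_self lam
  have perturbation_le : S.ε * ‖ξ‖ ≤ (l2Const S.ca + 1) / 6 * M := by
    calc S.ε * ‖ξ‖ ≤ S.ε * ((l2Const S.ca + 1) * S.δ * M) := by gcongr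
      _ = S.δ * S.ε * ((l2Const S.ca + 1) * M) := by ring
      _ ≤ 1 / 6 * ((l2Const S.ca + 1) * M) := by gcongr; exact S.small
      _ = (l2Const S.ca + 1) / 6 * M := by ring
  have form_le : S.ah ξ ξ + S.sp ξ ξ ≤
      stabConst S.ca * (stabConst S.ca + S.ca) * M ^ 2 + M * ((l2Const S.ca + 1) / 6 * M) :=
    (h.ah_add_sp_discreteError_le hu).trans (by gcongr)
  calc N ξ ^ 2 ≤ lam * ‖ξ‖ ^ 2 + cG * (S.ah ξ ξ + S.sp ξ ξ) := by
        linarith [garding ξ (h.discreteError_mem hu)]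
    _ ≤ |lam| * ((l2Const S.ca + 1) * S.δ * M) ^ 2 + cG *
          (stabConst S.ca * (stabConst S.ca + S.ca) * M ^ 2 + M * ((l2Const S.ca + 1) / 6 * M)) :=
        add_le_add lower_order_le (mul_le_mul_of_nonneg_left form_le hcG)
    _ = energyConst S.ca cG lam S.δ * M ^ 2 := by
        rw [energyConst]
        ring

end IsDiscreteSolution

lemma IsDiscreteSolution.eq_zero (h : S.IsDiscreteSolution 0 uh zh) (h₀ : S.approxError 0 = 0) :
    uh = 0 ∧ zh = 0 := by
  have stab_le := h.stabNorm_error_add_le (zero_mem _)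
  have error_le := h.norm_error_le (zero_mem _)
  have dual_le := h.norm_dual_le (zero_mem _)
  have hz := stabNorm_nonneg S.sa zh
  have he := stabNorm_nonneg S.sp (0 - uh)
  rw [h₀, mul_zero] at stab_le error_le
  have z_zero : stabNorm S.sa zh = 0 := by linarith
  have e_zero : stabNorm S.sp (0 - uh) = 0 := by linarith
  rw [z_zero, e_zero, mul_zero, add_zero, mul_zero] at dual_le
  rw [zero_sub, norm_neg] at error_le
  exact ⟨norm_le_zero_iff.1 error_le, norm_le_zero_iff.1 dual_le⟩

lemma existsUnique_isDiscreteSolution [FiniteDimensional ℝ S.Vh] (h₀ : S.approxError 0 = 0)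
    (hu : u ∈ S.Vₖ) : ∃! p : H × H, S.IsDiscreteSolution u p.1 p.2 := by
  have hle : S.Vh ≤ S.Vₖ ⊔ S.Vh := le_sup_right
  let a := (S.bilin.mono (le_sup_right : S.Vh ≤ _) (le_sup_right : S.Vh ≤ _)).toLinearMap₂
  let t := (S.stab_primal.mono hle).bilin.toLinearMap₂
  let F := (S.bilin.mono le_rfl (le_sup_right : S.Vh ≤ _)).toLinearMap₂
    ⟨u, Submodule.mem_sup_left (S.Vₖ_le hu)⟩
  let G := -(S.stab_primal.bilin.mono le_rfl hle).toLinearMap₂ ⟨u, Submodule.mem_sup_left hu⟩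
  have hom (x y : S.Vh) (primal : ∀ w, a x w + S.stab_dual.bilin.toLinearMap₂ y w = 0)
      (dual : ∀ v, a v y - t x v = 0) : x = 0 ∧ y = 0 := by
    have : S.IsDiscreteSolution 0 x y :=
      { primal_mem := x.2
        dual_mem := y.2
        primal := fun w hw => (primal ⟨w, hw⟩).trans
          (S.bilin.zero_left (Submodule.mem_sup_right hw)).symm
        dual := fun v hv => (dual ⟨v, hv⟩).trans
          (by rw [S.stab_primal.bilin.zero_left (hle hv), neg_zero]) }
    exact (this.eq_zero h₀).imp Subtype.ext Subtype.ext
  obtain ⟨⟨x, y⟩, ⟨primal, dual⟩, unique⟩ :=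
    existsUnique_saddlePoint a S.stab_dual.bilin.toLinearMap₂ t hom F G
  refine ⟨(x, y), ⟨x.2, y.2, fun w hw => primal ⟨w, hw⟩, fun v hv => dual ⟨v, hv⟩⟩, ?_⟩
  rintro ⟨x', y'⟩ h'
  have := unique (⟨x', h'.primal_mem⟩, ⟨y', h'.dual_mem⟩)
    ⟨fun w => h'.primal w w.2, fun v => h'.dual v v.2⟩
  simpa only [Prod.ext_iff, Subtype.ext_iff] using this

end StabilisedGalerkinMethod

section Sobolev

variable {d m : ℕ} {Ω : Set (E d)}

lemma HasWeakDeriv.unique (hΩ : IsOpen Ω) {β : Fin m → Fin d} {v g k : L2 Ω}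
    (hg : HasWeakDeriv Ω β v g) (hk : HasWeakDeriv Ω β v k) : g = k := by
  have locallyIntegrable (w : L2 Ω) : LocallyIntegrableOn w Ω volume :=
    locallyIntegrableOn_of_locallyIntegrable_restrict
      ((Lp.memLp w).locallyIntegrable (by norm_num))
  have integral_eq_zero (φ : E d → ℝ) (hφ : IsTestFunction Ω φ) :
      ∫ x, φ x • (g x - k x) = 0 := by
    have integral_eq : ∫ x in Ω, g x * φ x = ∫ x in Ω, k x * φ x :=
      mul_left_cancel₀ (pow_ne_zero m (by norm_num)) ((hg φ hφ).symm.trans (hk φ hφ))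
    have integrable (w : L2 Ω) : Integrable (fun x => w x * φ x) (volume.restrict Ω) :=
      (Lp.memLp w).integrable_mul hφ.memLp
    rw [← setIntegral_eq_integral_of_forall_compl_eq_zero (s := Ω) fun x hx => by
      rw [image_eq_zero_of_notMem_tsupport fun h => hx (hφ.support h), zero_smul]]
    simp only [smul_eq_mul, mul_comm (φ _), sub_mul]
    rw [integral_sub (integrable g) (integrable k), integral_eq, sub_self]
  have ae_eq := hΩ.ae_eq_zero_of_integral_contDiff_smul_eq_zero
    ((locallyIntegrable g).sub (locallyIntegrable k))
    fun φ smooth compact support => integral_eq_zero φ ⟨smooth, compact, support⟩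
  refine Lp.ext ((ae_restrict_iff' hΩ.measurableSet).2 ?_)
  filter_upwards [ae_eq] with x hx hxΩ
  exact sub_eq_zero.1 (hx hxΩ)

lemma HasWeakDeriv.weakDeriv_eq (hΩ : IsOpen Ω) {β : Fin m → Fin d} {v g : L2 Ω}
    (h : HasWeakDeriv Ω β v g) : weakDeriv Ω β v = g := by
  have exists_weakDeriv : ∃ g, HasWeakDeriv Ω β v g := ⟨g, h⟩
  rw [weakDeriv, dif_pos exists_weakDeriv]
  exact exists_weakDeriv.choose_spec.unique hΩ h

lemma hasWeakDeriv_weakDeriv {v : L2 Ω} (hv : v ∈ sobolev Ω m) (β : Fin m → Fin d) :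
    HasWeakDeriv Ω β v (weakDeriv Ω β v) := by
  rw [weakDeriv, dif_pos (hv m le_rfl β)]
  exact (hv m le_rfl β).choose_spec

lemma sobolev_anti {j : ℕ} (h : j ≤ m) : sobolev Ω m ≤ sobolev Ω j :=
  fun _ hv i hi β => hv i (hi.trans h) β

lemma weakDeriv_sub (hΩ : IsOpen Ω) {v w : L2 Ω} (hv : v ∈ sobolev Ω m) (hw : w ∈ sobolev Ω m)
    (β : Fin m → Fin d) : weakDeriv Ω β (v - w) = weakDeriv Ω β v - weakDeriv Ω β w := by
  refine HasWeakDeriv.weakDeriv_eq hΩ ?_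
  simpa only [neg_one_smul, ← sub_eq_add_neg] using
    (hasWeakDeriv_weakDeriv hv β).add ((hasWeakDeriv_weakDeriv hw β).smul (-1))

lemma weakDeriv_zero (hΩ : IsOpen Ω) (β : Fin m → Fin d) : weakDeriv Ω β (0 : L2 Ω) = 0 := by
  simpa only [sub_self] using weakDeriv_sub hΩ (zero_mem _) (zero_mem _) β

lemma seminormH_eq_norm (m : ℕ) (v : L2 Ω) :
    seminormH Ω m v = ‖WithLp.toLp 2 fun β : Fin m → Fin d => weakDeriv Ω β v‖ := by
  rw [PiLp.norm_eq_of_L2]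
  rfl

lemma seminormH_nonneg (m : ℕ) (v : L2 Ω) : 0 ≤ seminormH Ω m v := Real.sqrt_nonneg _

lemma seminormH_zero (hΩ : IsOpen Ω) (m : ℕ) : seminormH Ω m (0 : L2 Ω) = 0 := by
  simp [seminormH, weakDeriv_zero hΩ]

lemma seminormH_sub_le (hΩ : IsOpen Ω) {v w : L2 Ω} (hv : v ∈ sobolev Ω m)
    (hw : w ∈ sobolev Ω m) : seminormH Ω m (v - w) ≤ seminormH Ω m v + seminormH Ω m w := by
  simp only [seminormH_eq_norm, weakDeriv_sub hΩ hv hw]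
  exact norm_sub_le (WithLp.toLp 2 fun β : Fin m → Fin d => weakDeriv Ω β v)
    (WithLp.toLp 2 fun β : Fin m → Fin d => weakDeriv Ω β w)

end Sobolev

lemma finiteDimensional_of_piecewise {α ι X : Type*} [MeasurableSpace α] {μ : Measure α}
    {p : ENNReal} [Finite ι] [AddCommGroup X] [Module ℝ X] [FiniteDimensional ℝ X]
    (ev : X →ₗ[ℝ] α → ℝ) {s : ι → Set α} (cover : ∀ᵐ x ∂μ, ∃ i, x ∈ s i)
    {A : Submodule ℝ (Lp ℝ p μ)} (hA : ∀ v ∈ A, ∀ i, ∃ q, ∀ᵐ x ∂μ, x ∈ s i → v x = ev q x) :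
    FiniteDimensional ℝ A := by
  classical
  let glue : (ι → X) →ₗ[ℝ] α → ℝ := LinearMap.pi fun x =>
    if h : ∃ i, x ∈ s i then LinearMap.proj x ∘ₗ ev ∘ₗ LinearMap.proj h.choose else 0
  -- The pieces need not be measurable, so not every glued function lies in `Lp`.
  let P : Submodule ℝ (ι → X) :=
    { carrier := {q | MemLp (glue q) p μ}
      zero_mem' := by simp
      add_mem' := fun hq hr => by simpa using hq.add hr
      smul_mem' := fun c q hq => by simpa using hq.const_smul c }
  let toLp : P →ₗ[ℝ] Lp ℝ p μ :=
    { toFun := fun q => q.2.toLp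
      map_add' := fun q r => by simp [← MemLp.toLp_add]
      map_smul' := fun c q => by simp [← MemLp.toLp_const_smul] }
  suffices A ≤ LinearMap.range toLp from Submodule.finiteDimensional_of_le this
  intro v hv
  choose q hq using hA v hv
  have ae_eq : v =ᵐ[μ] glue q := by
    filter_upwards [cover, ae_all_iff.2 hq] with x hx hqx
    simp [glue, dif_pos hx, hqx _ hx.choose_spec]
  have mem : MemLp (glue q) p μ := (memLp_congr_ae ae_eq).1 (Lp.memLp v)
  exact ⟨⟨q, mem⟩, Lp.ext (mem.coeFn_toLp.trans ae_eq.symm)⟩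

namespace Triangulation

variable {d : ℕ} {Ω : Set (E d)} (T : Triangulation Ω)

lemma finite_cells : T.cells.Finite := by
  refine (T.finite.image fun s : Finset (E d) => convexHull ℝ (s : Set (E d))).subset ?_
  rintro K ⟨s, hs, -, rfl⟩
  exact ⟨s, hs, rfl⟩

lemma closure_subset_sUnion_cells : closure Ω ⊆ ⋃₀ T.cells := by
  rw [← T.space_eq]
  intro x hx
  obtain ⟨s, hs, hxs⟩ := Geometry.SimplicialComplex.mem_space_iff.1 hx
  obtain ⟨t, ht, hst, hcard⟩ := T.pure s hs
  exact ⟨_, ⟨t, ht, hcard, rfl⟩, convexHull_mono (Finset.coe_subset.2 hst) hxs⟩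

variable {T} in
lemma subset_closure_of_mem_cells {K : Set (E d)} (hK : K ∈ T.cells) : K ⊆ closure Ω := by
  obtain ⟨s, hs, -, rfl⟩ := hK
  rw [← T.space_eq]
  exact T.complex.convexHull_subset_space hs

variable {T} in
lemma isBounded_of_mem_cells {K : Set (E d)} (hK : K ∈ T.cells) : Bornology.IsBounded K := by
  obtain ⟨s, -, -, rfl⟩ := hK
  exact isBounded_convexHull.2 s.finite_toSet.isBounded

include T in
lemma isBounded_closure : Bornology.IsBounded (closure Ω) :=
  ((Bornology.isBounded_sUnion T.finite_cells).2 fun _ => isBounded_of_mem_cells).subset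
    T.closure_subset_sUnion_cells

lemma meshSize_le_diam : T.meshSize ≤ Metric.diam (closure Ω) := by
  refine Real.sSup_le ?_ Metric.diam_nonneg
  rintro _ ⟨K, hK, rfl⟩
  exact Metric.diam_mono (subset_closure_of_mem_cells hK) T.isBounded_closure

lemma meshSize_pos (hd : 0 < d) (hΩ : Ω.Nonempty) : 0 < T.meshSize := by
  obtain ⟨x, hx⟩ := hΩ
  obtain ⟨K, hK, -⟩ := T.closure_subset_sUnion_cells (subset_closure hx)
  have diam_le : Metric.diam K ≤ T.meshSize :=
    le_csSup (T.finite_cells.image Metric.diam).bddAbove (Set.mem_image_of_mem _ hK)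
  have bounded := isBounded_of_mem_cells hK
  obtain ⟨s, -, hcard, rfl⟩ := hK
  obtain ⟨p, hp, q, hq, hpq⟩ := Finset.one_lt_card.1 (show 1 < s.card by omega)
  exact ((dist_pos.2 hpq).trans_le (Metric.dist_le_diam_of_mem bounded
    (subset_convexHull ℝ _ hp) (subset_convexHull ℝ _ hq))).trans_le diam_le

lemma finiteDimensional_feSpace (hΩ : MeasurableSet Ω) (k : ℕ) :
    FiniteDimensional ℝ (T.feSpace k) := by
  have := T.finite_cells.to_subtype
  have cover : ∀ᵐ x ∂volume.restrict Ω, ∃ K : T.cells, x ∈ (K : Set (E d)) := by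
    filter_upwards [ae_restrict_mem hΩ] with x hx
    obtain ⟨K, hK, hxK⟩ := T.closure_subset_sUnion_cells (subset_closure hx)
    exact ⟨⟨K, hK⟩, hxK⟩
  let ev : MvPolynomial.restrictTotalDegree (Fin d) ℝ k →ₗ[ℝ] E d → ℝ :=
    (LinearMap.pi fun x => (MvPolynomial.aeval fun i => x i).toLinearMap) ∘ₗ Submodule.subtype _
  refine finiteDimensional_of_piecewise ev cover fun v hv K => ?_
  obtain ⟨p, hp, hpv⟩ := hv.2 K K.2
  exact ⟨⟨p, (MvPolynomial.mem_restrictTotalDegree _ _ _).2 hp⟩, by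
    simpa [ev, MvPolynomial.aeval_eq_eval] using hpv⟩

end Triangulation

/-- The primal-dual stabilised finite element method for the continuous problem
`a(u, w) = (f, w)`, with the properties that its error analysis uses. The parameters `cΩ`, `ci`,
`ca`, `cγ`, `cG` and `lam` are the constants of the smoothing property and of the interpolation,
continuity, approximation and Gårding inequalities. The discrete space need not come from a
triangulation, and `h` stands for the mesh size. -/
structure StabilisedFEM {d : ℕ} (Ω : Set (E d)) (k : ℕ) (cΩ ci ca cγ cG lam : ℝ) where
  V : Submodule ℝ (L2 Ω)
  W : Submodule ℝ (L2 Ω)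
  Vh : Submodule ℝ (L2 Ω)
  a : L2 Ω → L2 Ω → ℝ
  ah : L2 Ω → L2 Ω → ℝ
  sa : L2 Ω → L2 Ω → ℝ
  sp : L2 Ω → L2 Ω → ℝ
  πV : L2 Ω → L2 Ω
  πW : L2 Ω → L2 Ω
  Nplus : L2 Ω → ℝ
  Nstar : L2 Ω → ℝ
  NL : L2 Ω → ℝ
  h : ℝ
  ε : ℝ
  cΩ_pos : 0 < cΩ
  ci_pos : 0 < ci
  ca_pos : 0 < ca
  cγ_pos : 0 < cγ
  cG_pos : 0 < cG
  h_pos : 0 < h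
  ε_nonneg : 0 ≤ ε
  Vh_le : Vh ≤ sobolev Ω 1
  finiteDimensional : FiniteDimensional ℝ Vh
  exists_forward : ∀ f, ∃ u, SolvesForward V W a f u
  exists_adjoint : ∀ g, ∃ z, SolvesAdjoint V W a g z
  forward_smoothing : ∀ f u, SolvesForward V W a f u →
    u ∈ sobolev Ω 2 ∧ seminormH Ω 2 u ≤ cΩ * ‖f‖
  adjoint_smoothing : ∀ g z, SolvesAdjoint V W a g z →
    z ∈ sobolev Ω 2 ∧ seminormH Ω 2 z ≤ cΩ * ‖g‖
  bilin : IsBilinOn ((V ⊓ sobolev Ω 2) ⊔ Vh) ((W ⊓ sobolev Ω 2) ⊔ Vh) ah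
  stab_primal : IsStabilisationOn ((V ⊓ sobolev Ω (k + 1)) ⊔ Vh) sp
  stab_dual : IsStabilisationOn Vh sa
  stab_eq : ∀ v ∈ Vh, ∀ w ∈ Vh, sa v w = sp v w
  πV_mem : ∀ v ∈ V ⊓ sobolev Ω 2, πV v ∈ Vh
  πW_mem : ∀ w ∈ W ⊓ sobolev Ω 2, πW w ∈ Vh
  Nplus_nonneg : ∀ v ∈ (V ⊓ sobolev Ω 2) ⊔ Vh, 0 ≤ Nplus v
  NL_nonneg : ∀ v ∈ (V ⊓ sobolev Ω 2) ⊔ Vh, 0 ≤ NL v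
  forward_consistent : ∀ f u, SolvesForward V W a f u →
    ∀ φ ∈ (W ⊓ sobolev Ω 2) ⊔ Vh, ah u φ = inner ℝ f φ
  adjoint_consistent : ∀ g z, SolvesAdjoint V W a g z →
    ∀ φ ∈ (V ⊓ sobolev Ω 2) ⊔ Vh, ah φ z = inner ℝ φ g
  interpolation : ∀ v ∈ V ⊓ sobolev Ω (k + 1),
    ‖v - πV v‖ + h * gradNorm Ω (v - πV v) ≤ ci * h ^ (k + 1) * seminormH Ω (k + 1) v
  continuous_left : ∀ v ∈ V ⊓ sobolev Ω 2, ∀ xh ∈ Vh,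
    ah (v - πV v) xh ≤ Nplus (v - πV v) * (ca * stabNorm sa xh + ε * ‖xh‖)
  continuous_right : ∀ v ∈ V ⊓ sobolev Ω 2, ∀ vh ∈ Vh, ∀ y ∈ W ⊓ sobolev Ω 2,
    ah (v - vh) (y - πW y) ≤
      Nstar (y - πW y) * (ca * NL (v - πV v) + ca * stabNorm sp (vh - πV v) + ε * ‖v - vh‖)
  approximation : ∀ v ∈ V ⊓ sobolev Ω (k + 1),
    NL (v - πV v) + Nplus (v - πV v) + stabNorm sp (v - πV v) ≤
      cγ * h ^ k * seminormH Ω (k + 1) v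
  Nplus_le : ∀ v ∈ V ⊓ sobolev Ω 2, Nplus (v - πV v) ≤ cγ * h * seminormH Ω 2 v
  Nstar_le : ∀ w ∈ W ⊓ sobolev Ω 2, Nstar (w - πW w) ≤ cγ * h * seminormH Ω 2 w
  stabNorm_πV_le : ∀ v ∈ V ⊓ sobolev Ω 2, stabNorm sp (πV v) ≤ cγ * h * seminormH Ω 2 v
  stabNorm_πW_le : ∀ w ∈ W ⊓ sobolev Ω 2, stabNorm sa (πW w) ≤ cγ * h * seminormH Ω 2 w
  small : cγ * cΩ * h * ε ≤ 1 / 6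
  garding : ∀ vh ∈ Vh, gradNorm Ω vh ^ 2 - lam * ‖vh‖ ^ 2 ≤ cG * (ah vh vh + sp vh vh)

/-- The constant of the `H¹` error estimate on meshes of size at most `D`. The summand
`ci / (cγ * cΩ)` makes the interpolation error in `L²(Ω)` compatible with the rate `cγ * cΩ * h` at
which solutions of the continuous problems are approximated. -/
noncomputable def errorConst (cΩ ci ca cγ cG lam D : ℝ) : ℝ :=
  ci + √(energyConst ca cG lam (cγ * cΩ * D)) * (cγ + ci / (cγ * cΩ))

lemma errorConst_pos {cΩ ci ca cγ cG lam D : ℝ} (hcΩ : 0 < cΩ) (hci : 0 < ci) (hcγ : 0 < cγ) :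
    0 < errorConst cΩ ci ca cγ cG lam D := by
  unfold errorConst
  positivity

namespace StabilisedFEM

variable {d k : ℕ} {Ω : Set (E d)} {cΩ ci ca cγ cG lam : ℝ}
  (S : StabilisedFEM Ω k cΩ ci ca cγ cG lam) {f u uh zh : L2 Ω}

lemma smoothing_rate_le {x y : ℝ} (hx : x ≤ cΩ * y) : cγ * S.h * x ≤ cγ * cΩ * S.h * y := by
  have := S.cγ_pos
  have := S.h_pos
  calc cγ * S.h * x ≤ cγ * S.h * (cΩ * y) := by gcongr
    _ = cγ * cΩ * S.h * y := by ring

lemma exists_forward_approximable (g : L2 Ω) : ∃ φ ∈ S.V ⊓ sobolev Ω 2,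
    (∀ w ∈ S.Vh, S.ah φ w = inner ℝ g w) ∧ S.Nplus (φ - S.πV φ) ≤ cγ * cΩ * S.h * ‖g‖ ∧
      stabNorm S.sp (S.πV φ) ≤ cγ * cΩ * S.h * ‖g‖ := by
  obtain ⟨φ, solves⟩ := S.exists_forward g
  obtain ⟨smooth, seminorm_le⟩ := S.forward_smoothing g φ solves
  have mem : φ ∈ S.V ⊓ sobolev Ω 2 := ⟨solves.1, smooth⟩
  have rate_le := S.smoothing_rate_le seminorm_le
  exact ⟨φ, mem, fun w hw => S.forward_consistent g φ solves w (Submodule.mem_sup_right hw),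
    (S.Nplus_le φ mem).trans rate_le, (S.stabNorm_πV_le φ mem).trans rate_le⟩

lemma exists_adjoint_approximable (g : L2 Ω) : ∃ ζ ∈ S.W ⊓ sobolev Ω 2,
    (∀ v ∈ (S.V ⊓ sobolev Ω 2) ⊔ S.Vh, S.ah v ζ = inner ℝ v g) ∧
      S.Nstar (ζ - S.πW ζ) ≤ cγ * cΩ * S.h * ‖g‖ ∧
        stabNorm S.sa (S.πW ζ) ≤ cγ * cΩ * S.h * ‖g‖ := by
  obtain ⟨ζ, solves⟩ := S.exists_adjoint g
  obtain ⟨smooth, seminorm_le⟩ := S.adjoint_smoothing g ζ solves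
  have mem : ζ ∈ S.W ⊓ sobolev Ω 2 := ⟨solves.1, smooth⟩
  have rate_le := S.smoothing_rate_le seminorm_le
  exact ⟨ζ, mem, S.adjoint_consistent g ζ solves,
    (S.Nstar_le ζ mem).trans rate_le, (S.stabNorm_πW_le ζ mem).trans rate_le⟩

/-- The method as a Galerkin method in `L²(Ω)`: elliptic regularity and the first order
approximation estimates give the rate `δ = cγ * cΩ * h`. -/
noncomputable def toStabilisedGalerkinMethod (hk : 1 ≤ k) : StabilisedGalerkinMethod (L2 Ω) where
  V₂ := S.V ⊓ sobolev Ω 2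
  W₂ := S.W ⊓ sobolev Ω 2
  Vₖ := S.V ⊓ sobolev Ω (k + 1)
  Vh := S.Vh
  ah := S.ah
  sa := S.sa
  sp := S.sp
  πV := S.πV
  πW := S.πW
  Nplus := S.Nplus
  Nstar := S.Nstar
  NL := S.NL
  ca := ca
  δ := cγ * cΩ * S.h
  ε := S.ε
  Vₖ_le := inf_le_inf_left _ (sobolev_anti (Nat.succ_le_succ hk))
  bilin := S.bilin
  stab_primal := S.stab_primal
  stab_dual := S.stab_dual
  stab_eq := S.stab_eq
  πV_mem := S.πV_mem
  πW_mem := S.πW_mem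
  Nplus_nonneg := S.Nplus_nonneg
  NL_nonneg := S.NL_nonneg
  forward := S.exists_forward_approximable
  adjoint := S.exists_adjoint_approximable
  continuous_left := S.continuous_left
  continuous_right := S.continuous_right
  ca_nonneg := S.ca_pos.le
  δ_nonneg := (mul_pos (mul_pos S.cγ_pos S.cΩ_pos) S.h_pos).le
  ε_nonneg := S.ε_nonneg
  small := S.small

variable {S} (hk : 1 ≤ k)

lemma solvesFEM_iff_isDiscreteSolution (hfu : SolvesForward S.V S.W S.a f u) :
    SolvesFEM S.Vh S.ah S.sa S.sp f u uh zh ↔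
      (S.toStabilisedGalerkinMethod hk).IsDiscreteSolution u uh zh := by
  have consistent (w : L2 Ω) (hw : w ∈ S.Vh) : S.ah u w = inner ℝ f w :=
    S.forward_consistent f u hfu w (Submodule.mem_sup_right hw)
  exact ⟨fun h => ⟨h.primal_mem, h.dual_mem,
      fun w hw => (h.primal w hw).trans (consistent w hw).symm, h.dual⟩,
    fun h => ⟨h.primal_mem, h.dual_mem,
      fun w hw => (h.primal w hw).trans (consistent w hw), h.dual⟩⟩

lemma approxError_le (hu : u ∈ S.V ⊓ sobolev Ω (k + 1)) :
    (S.toStabilisedGalerkinMethod hk).approxError u ≤ cγ * (S.h ^ k * seminormH Ω (k + 1) u) :=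
  (S.approximation u hu).trans_eq (mul_assoc _ _ _)

lemma approxError_zero (hΩ : IsOpen Ω) : (S.toStabilisedGalerkinMethod hk).approxError 0 = 0 := by
  refine le_antisymm ((approxError_le hk (zero_mem _)).trans_eq ?_)
    (StabilisedGalerkinMethod.approxError_nonneg (zero_mem _))
  rw [seminormH_zero hΩ, mul_zero, mul_zero]

lemma norm_sub_πV_le (hu : u ∈ S.V ⊓ sobolev Ω (k + 1)) :
    ‖u - S.πV u‖ ≤ ci * S.h * (S.h ^ k * seminormH Ω (k + 1) u) := by
  have := mul_nonneg S.h_pos.le (seminormH_nonneg (Ω := Ω) 1 (u - S.πV u))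
  calc ‖u - S.πV u‖ ≤ ‖u - S.πV u‖ + S.h * gradNorm Ω (u - S.πV u) := le_add_of_nonneg_right this
    _ ≤ ci * S.h ^ (k + 1) * seminormH Ω (k + 1) u := S.interpolation u hu
    _ = ci * S.h * (S.h ^ k * seminormH Ω (k + 1) u) := by ring

lemma gradNorm_sub_πV_le (hu : u ∈ S.V ⊓ sobolev Ω (k + 1)) :
    gradNorm Ω (u - S.πV u) ≤ ci * (S.h ^ k * seminormH Ω (k + 1) u) := by
  refine le_of_mul_le_mul_left ?_ S.h_pos
  calc S.h * gradNorm Ω (u - S.πV u) ≤ ‖u - S.πV u‖ + S.h * gradNorm Ω (u - S.πV u) :=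
        le_add_of_nonneg_left (norm_nonneg _)
    _ ≤ ci * S.h ^ (k + 1) * seminormH Ω (k + 1) u := S.interpolation u hu
    _ = S.h * (ci * (S.h ^ k * seminormH Ω (k + 1) u)) := by ring

lemma existsUnique_solvesFEM (hΩ : IsOpen Ω) (hk : 1 ≤ k) (hfu : SolvesForward S.V S.W S.a f u)
    (hu : u ∈ sobolev Ω (k + 1)) :
    ∃! p : L2 Ω × L2 Ω, SolvesFEM S.Vh S.ah S.sa S.sp f u p.1 p.2 := by
  have : FiniteDimensional ℝ (S.toStabilisedGalerkinMethod hk).Vh := S.finiteDimensional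
  simp only [solvesFEM_iff_isDiscreteSolution hk hfu]
  exact StabilisedGalerkinMethod.existsUnique_isDiscreteSolution (approxError_zero hk hΩ)
    ⟨hfu.1, hu⟩

lemma gradNorm_discreteError_le {D : ℝ} (hk : 1 ≤ k) (hD : S.h ≤ D)
    (hfu : SolvesForward S.V S.W S.a f u) (hu : u ∈ sobolev Ω (k + 1))
    (h : SolvesFEM S.Vh S.ah S.sa S.sp f u uh zh) :
    gradNorm Ω (uh - S.πV u) ≤ √(energyConst ca cG lam (cγ * cΩ * D)) *
      ((cγ + ci / (cγ * cΩ)) * (S.h ^ k * seminormH Ω (k + 1) u)) := by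
  have hcΩ := S.cΩ_pos
  have hci := S.ci_pos
  have hcγ := S.cγ_pos
  have hh := S.h_pos
  have mem : u ∈ S.V ⊓ sobolev Ω (k + 1) := ⟨hfu.1, hu⟩
  have hY : 0 ≤ S.h ^ k * seminormH Ω (k + 1) u := mul_nonneg (by positivity) (seminormH_nonneg _ _)
  have approx_le := approxError_le hk mem
  have interpolation_le := norm_sub_πV_le mem
  set Y := S.h ^ k * seminormH Ω (k + 1) u
  have approx_le' : (S.toStabilisedGalerkinMethod hk).approxError u ≤ (cγ + ci / (cγ * cΩ)) * Y :=
    approx_le.trans (by gcongr; exact le_add_of_nonneg_right (by positivity))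
  have interpolation_le' : ‖u - S.πV u‖ ≤ cγ * cΩ * S.h * ((cγ + ci / (cγ * cΩ)) * Y) := by
    calc ‖u - S.πV u‖ ≤ cγ * cΩ * S.h * (ci / (cγ * cΩ) * Y) :=
          interpolation_le.trans_eq (by field_simp)
      _ ≤ cγ * cΩ * S.h * ((cγ + ci / (cγ * cΩ)) * Y) := by
          gcongr
          exact le_add_of_nonneg_left hcγ.le
  have sq_le : gradNorm Ω (uh - S.πV u) ^ 2 ≤
      energyConst ca cG lam (cγ * cΩ * S.h) * ((cγ + ci / (cγ * cΩ)) * Y) ^ 2 :=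
    ((solvesFEM_iff_isDiscreteSolution hk hfu).1 h).sq_discreteError_le_of_garding mem
      S.cG_pos.le S.garding approx_le' interpolation_le'
  rw [← Real.sqrt_sq (by positivity : 0 ≤ (cγ + ci / (cγ * cΩ)) * Y),
    ← Real.sqrt_mul' _ (sq_nonneg _)]
  refine Real.le_sqrt_of_sq_le (sq_le.trans ?_)
  gcongr
  exact energyConst_le_energyConst S.ca_pos.le (by positivity) (by gcongr)

lemma gradNorm_error_le {D : ℝ} (hΩ : IsOpen Ω) (hk : 1 ≤ k) (hD : S.h ≤ D)
    (hfu : SolvesForward S.V S.W S.a f u) (hu : u ∈ sobolev Ω (k + 1))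
    (h : SolvesFEM S.Vh S.ah S.sa S.sp f u uh zh) :
    gradNorm Ω (u - uh) ≤
      errorConst cΩ ci ca cγ cG lam D * S.h ^ k * seminormH Ω (k + 1) u := by
  have πu_mem : S.πV u ∈ sobolev Ω 1 :=
    S.Vh_le (S.πV_mem u ⟨hfu.1, sobolev_anti (Nat.succ_le_succ hk) hu⟩)
  have u_mem : u ∈ sobolev Ω 1 := sobolev_anti (Nat.le_add_left 1 k) hu
  have triangle : gradNorm Ω (u - uh) ≤ gradNorm Ω (u - S.πV u) + gradNorm Ω (uh - S.πV u) := by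
    rw [← sub_sub_sub_cancel_right u uh (S.πV u)]
    exact seminormH_sub_le hΩ (sub_mem u_mem πu_mem) (sub_mem (S.Vh_le h.primal_mem) πu_mem)
  refine triangle.trans ((add_le_add (gradNorm_sub_πV_le ⟨hfu.1, hu⟩)
    (gradNorm_discreteError_le hk hD hfu hu h)).trans_eq ?_)
  rw [errorConst]
  ring

end StabilisedFEM

end StabFEM

theorem mainTheorem12_general {d k : ℕ} {Ω : Set (StabFEM.E d)} {cΩ ci ca cγ cG lam D : ℝ}
    (hΩ : IsOpen Ω) (hk : 1 ≤ k) (S : StabFEM.StabilisedFEM Ω k cΩ ci ca cγ cG lam) (hD : S.h ≤ D)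
    {f u : StabFEM.L2 Ω} (hfu : StabFEM.SolvesForward S.V S.W S.a f u)
    (hu : u ∈ StabFEM.sobolev Ω (k + 1)) :
    ∃ uh zh, StabFEM.SolvesFEM S.Vh S.ah S.sa S.sp f u uh zh ∧
      (∀ uh' zh', StabFEM.SolvesFEM S.Vh S.ah S.sa S.sp f u uh' zh' → uh' = uh ∧ zh' = zh) ∧
      StabFEM.gradNorm Ω (u - uh) ≤ StabFEM.errorConst cΩ ci ca cγ cG lam D * S.h ^ k *
        StabFEM.seminormH Ω (k + 1) u := by
  obtain ⟨⟨uh, zh⟩, solves, unique⟩ := StabFEM.StabilisedFEM.existsUnique_solvesFEM hΩ hk hfu hu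
  exact ⟨uh, zh, solves, fun uh' zh' h' => Prod.ext_iff.1 (unique (uh', zh') h'),
    StabFEM.StabilisedFEM.gradNorm_error_le hΩ hk hD hfu hu solves⟩

theorem mainTheorem12 (d : ℕ) (hd : d = 2 ∨ d = 3) (Ω : Set (StabFEM.E d))
    (hΩ : IsOpen Ω) (hΩne : Ω.Nonempty) (k : ℕ) (hk : 1 ≤ k)
    -- constants of the smoothing property, interpolation, continuity, approximation and
    -- Gårding inequalities; they are fixed before the forms, the mesh and the solution
    (cΩ ci ca cγ cG lam : ℝ)
    (hcΩ : 0 < cΩ) (hci : 0 < ci) (hca : 0 < ca) (hcγ : 0 < cγ) (hcG : 0 < cG) :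
    ∃ C : ℝ, 0 < C ∧
      ∀ (V W : Submodule ℝ (StabFEM.L2 Ω)) (a : StabFEM.L2 Ω → StabFEM.L2 Ω → ℝ),
      V ≤ StabFEM.sobolev Ω 1 → W ≤ StabFEM.sobolev Ω 1 → StabFEM.IsBilinOn V W a →
      -- well-posedness of the forward and the adjoint problem
      (∀ f : StabFEM.L2 Ω, ∃! u, StabFEM.SolvesForward V W a f u) →
      (∀ g : StabFEM.L2 Ω, ∃! z, StabFEM.SolvesAdjoint V W a g z) →
      -- smoothing property
      (∀ f u, StabFEM.SolvesForward V W a f u →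
        u ∈ StabFEM.sobolev Ω 2 ∧ StabFEM.seminormH Ω 2 u ≤ cΩ * ‖f‖) →
      (∀ g z, StabFEM.SolvesAdjoint V W a g z →
        z ∈ StabFEM.sobolev Ω 2 ∧ StabFEM.seminormH Ω 2 z ≤ cΩ * ‖g‖) →
      -- the mesh (neither shape regular nor quasi-uniform), the discrete space and its mesh size
      ∀ (T : StabFEM.Triangulation Ω) (Vh : Submodule ℝ (StabFEM.L2 Ω)) (h : ℝ),
      Vh ≤ T.feSpace k → h = T.meshSize →
      -- the discrete forms, interpolation operators, seminorms, and the number `ε = ε(h)`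
      ∀ (ah sa sp : StabFEM.L2 Ω → StabFEM.L2 Ω → ℝ) (πV πW : StabFEM.L2 Ω → StabFEM.L2 Ω)
        (Nplus Nstar NL : StabFEM.L2 Ω → ℝ) (ε : ℝ),
      StabFEM.IsBilinOn ((V ⊓ StabFEM.sobolev Ω 2) ⊔ Vh) ((W ⊓ StabFEM.sobolev Ω 2) ⊔ Vh) ah →
      StabFEM.IsStabilisationOn ((V ⊓ StabFEM.sobolev Ω (k + 1)) ⊔ Vh) sp →
      StabFEM.IsStabilisationOn ((W ⊓ StabFEM.sobolev Ω (k + 1)) ⊔ Vh) sa →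
      StabFEM.IsSeminormOn ((V ⊓ StabFEM.sobolev Ω 2) ⊔ Vh) Nplus →
      StabFEM.IsSeminormOn ((W ⊓ StabFEM.sobolev Ω 2) ⊔ Vh) Nstar →
      StabFEM.IsSeminormOn ((V ⊓ StabFEM.sobolev Ω 2) ⊔ Vh) NL →
      (∀ v ∈ V ⊓ StabFEM.sobolev Ω 2, πV v ∈ Vh) →
      (∀ w ∈ W ⊓ StabFEM.sobolev Ω 2, πW w ∈ Vh) →
      0 ≤ ε →
      -- strong consistency
      (∀ f u, StabFEM.SolvesForward V W a f u →
        ∀ φ ∈ (W ⊓ StabFEM.sobolev Ω 2) ⊔ Vh, ah u φ = inner ℝ f φ) →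
      (∀ g z, StabFEM.SolvesAdjoint V W a g z →
        ∀ φ ∈ (V ⊓ StabFEM.sobolev Ω 2) ⊔ Vh, ah φ z = inner ℝ φ g) →
      -- interpolation estimates
      (∀ v ∈ V ⊓ StabFEM.sobolev Ω (k + 1),
        ‖v - πV v‖ + h * StabFEM.gradNorm Ω (v - πV v)
          ≤ ci * h ^ (k + 1) * StabFEM.seminormH Ω (k + 1) v) →
      (∀ w ∈ W ⊓ StabFEM.sobolev Ω (k + 1),
        ‖w - πW w‖ + h * StabFEM.gradNorm Ω (w - πW w)
          ≤ ci * h ^ (k + 1) * StabFEM.seminormH Ω (k + 1) w) →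
      -- continuity relations
      (∀ v ∈ V ⊓ StabFEM.sobolev Ω 2, ∀ xh ∈ Vh,
        ah (v - πV v) xh ≤ Nplus (v - πV v) * (ca * StabFEM.stabNorm sa xh + ε * ‖xh‖)) →
      (∀ v ∈ V ⊓ StabFEM.sobolev Ω 2, ∀ vh ∈ Vh, ∀ y ∈ W ⊓ StabFEM.sobolev Ω 2,
        ah (v - vh) (y - πW y) ≤ Nstar (y - πW y) *
          (ca * NL (v - πV v) + ca * StabFEM.stabNorm sp (vh - πV v) + ε * ‖v - vh‖)) →
      -- approximation estimates of order `k`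
      (∀ v ∈ V ⊓ StabFEM.sobolev Ω (k + 1),
        NL (v - πV v) + Nplus (v - πV v) + StabFEM.stabNorm sp (v - πV v)
          ≤ cγ * h ^ k * StabFEM.seminormH Ω (k + 1) v) →
      (∀ w ∈ W ⊓ StabFEM.sobolev Ω (k + 1),
        Nstar (w - πW w) + StabFEM.stabNorm sa (w - πW w)
          ≤ cγ * h ^ k * StabFEM.seminormH Ω (k + 1) w) →
      -- first order approximation of `H²` functions
      (∀ v ∈ V ⊓ StabFEM.sobolev Ω 2, Nplus (v - πV v) ≤ cγ * h * StabFEM.seminormH Ω 2 v) →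
      (∀ w ∈ W ⊓ StabFEM.sobolev Ω 2, Nstar (w - πW w) ≤ cγ * h * StabFEM.seminormH Ω 2 w) →
      -- upper bounds for the stabilisation of interpolants
      (∀ w ∈ W ⊓ StabFEM.sobolev Ω 2,
        StabFEM.stabNorm sa (πW w) ≤ cγ * h * StabFEM.seminormH Ω 2 w) →
      (∀ v ∈ V ⊓ StabFEM.sobolev Ω 2,
        StabFEM.stabNorm sp (πV v) ≤ cγ * h * StabFEM.seminormH Ω 2 v) →
      -- smallness of `h ε(h)`
      cγ * cΩ * h * ε ≤ 1 / 6 →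
      -- Gårding inequality, and equality of the two stabilisations
      (∀ vh ∈ Vh, StabFEM.gradNorm Ω vh ^ 2 - lam * ‖vh‖ ^ 2 ≤ cG * (ah vh vh + sp vh vh)) →
      (∀ vh ∈ Vh, ∀ wh ∈ Vh, sa vh wh = sp vh wh) →
      ∀ f u, StabFEM.SolvesForward V W a f u → u ∈ StabFEM.sobolev Ω (k + 1) →
        ∃ uh zh, StabFEM.SolvesFEM Vh ah sa sp f u uh zh ∧
          (∀ uh' zh', StabFEM.SolvesFEM Vh ah sa sp f u uh' zh' → uh' = uh ∧ zh' = zh) ∧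
          StabFEM.gradNorm Ω (u - uh) ≤ C * h ^ k * StabFEM.seminormH Ω (k + 1) u := by
  refine ⟨StabFEM.errorConst cΩ ci ca cγ cG lam (Metric.diam (closure Ω)),
    StabFEM.errorConst_pos hcΩ hci hcγ, ?_⟩
  rintro V W a - - - forward adjoint forward_smoothing adjoint_smoothing T Vh h Vh_le rfl
    ah sa sp πV πW Nplus Nstar NL ε bilin stab_primal stab_dual seminorm_plus - seminorm_L
    πV_mem πW_mem ε_nonneg forward_consistent adjoint_consistent interpolation -
    continuous_left continuous_right approximation - Nplus_le Nstar_le stabNorm_πW_le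
    stabNorm_πV_le small garding stab_eq f u
  have := T.finiteDimensional_feSpace hΩ.measurableSet k
  exact mainTheorem12_general hΩ hk
    { V, W, Vh, a, ah, sa, sp, πV, πW, Nplus, Nstar, NL, ε, h := T.meshSize
      cΩ_pos := hcΩ, ci_pos := hci, ca_pos := hca, cγ_pos := hcγ, cG_pos := hcG
      h_pos := T.meshSize_pos (by lia) hΩne, ε_nonneg
      Vh_le := Vh_le.trans fun _ hv => hv.1
      finiteDimensional := Submodule.finiteDimensional_of_le Vh_le
      exists_forward := fun f => (forward f).exists
      exists_adjoint := fun g => (adjoint g).exists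
      forward_smoothing, adjoint_smoothing, bilin, stab_primal
      stab_dual := stab_dual.mono le_sup_right, stab_eq, πV_mem, πW_mem
      Nplus_nonneg := seminorm_plus.nonneg, NL_nonneg := seminorm_L.nonneg
      forward_consistent, adjoint_consistent, interpolation, continuous_left, continuous_right
      approximation, Nplus_le, Nstar_le, stabNorm_πV_le, stabNorm_πW_le, small, garding }
    T.meshSize_le_diam
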